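/- Let $n,p\ge 1$ and let $G_{n,p}=C_p\wr S_n$ be the group of $p$-colored permutations: its elements are pairs $(s,\sigma)$ with $s\in(\mathbb Z/p\mathbb Z)^n$ and $\sigma\in S_n$, with product $(t,\tau)(s,\sigma)=\bigl((t_{\sigma(i)}+s_i)_{1\le i\le n},\,\tau\sigma\bigr)$; we think of $\sigma(i)$ as the label in position $i$ and of $s_i$ as its color. For $1\le m\le n$ let $Q^{(m)}$ (one step of colored top-$m$-to-random) be the uniform probability law on the set of those $(s,\sigma)\in G_{n,p}$ in which the labels $m+1,\dots,n$ appear in increasing order, i.e. $\sigma^{-1}(m+1)<\cdots<\sigma^{-1}(n)$, and all have color $0$. Let $(Q^{(m)})^{*k}$ be its $k$-fold convolution power (with $(Q^{(m)})^{*0}=\delta_e$), let $U$ be the uniform law on $G_{n,p}$, and let $\mathrm{sep}(M,U)=1-\min_{x\in G_{n,p}} M(x)/U(x)$. Fix $p\ge 2$, $m\ge 1$ (independent of $n$) and $0<\varepsilon<1$. Then for every $n\ge m$ the separation mixing time $$t_{\mathrm{sep}}^{(m)}(\varepsilon)=\min\bigl\{k\ge 0:\ \mathrm{sep}\bigl((Q^{(m)})^{*k},U\bigr)\le\varepsilon\bigr\}$$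 is well defined (the set is nonempty), and as $n\to\infty$ $$t_{\mathrm{sep}}^{(m)}(\varepsilon)=\frac nm\Bigl(\log n-\log\bigl(-\log(1-\varepsilon)\bigr)\Bigr)+o(n).$$ -/

import Mathlib

open Filter Asymptotics

/-- A `p`-colored permutation of `n` labels, i.e. an element `(s, σ)` of `C_p ≀ S_n`, read as the word
`(s 0, σ 0) (s 1, σ 1) … (s (n-1), σ (n-1))`: `perm t` is the label in position `t` and `color t` is
its color.  The labels `1, …, n` are represented by `0, …, n - 1`. -/
@[ext]
structure ColoredPerm (n p : ℕ) where
  color : Fin n → ZMod p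
  perm : Equiv.Perm (Fin n)

namespace ColoredPerm

variable {n p : ℕ}

/-- `(t, τ) (s, σ) = (σ t + s, τ σ)` with `σ t = (t (σ 1), …, t (σ n))`. -/
instance : Mul (ColoredPerm n p) :=
  ⟨fun x y => ⟨fun i => x.color (y.perm i) + y.color i, x.perm * y.perm⟩⟩

instance : One (ColoredPerm n p) := ⟨⟨0, 1⟩⟩

instance : Inv (ColoredPerm n p) :=
  ⟨fun x => ⟨fun i => -x.color (x.perm⁻¹ i), x.perm⁻¹⟩⟩

@[simp] theorem mul_color (x y : ColoredPerm n p) (i : Fin n) :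
    (x * y).color i = x.color (y.perm i) + y.color i := rfl

@[simp] theorem mul_perm (x y : ColoredPerm n p) : (x * y).perm = x.perm * y.perm := rfl

@[simp] theorem one_color (i : Fin n) : (1 : ColoredPerm n p).color i = 0 := rfl

@[simp] theorem one_perm : (1 : ColoredPerm n p).perm = 1 := rfl

@[simp] theorem inv_color (x : ColoredPerm n p) (i : Fin n) :
    (x⁻¹).color i = -x.color (x.perm⁻¹ i) := rfl

@[simp] theorem inv_perm (x : ColoredPerm n p) : (x⁻¹).perm = x.perm⁻¹ := rfl

instance : Group (ColoredPerm n p) :=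
  Group.ofLeftAxioms
    (fun x y z => by
      ext i
      · simp [add_assoc]
      · simp)
    (fun x => by
      ext i
      · simp
      · simp)
    (fun x => by
      ext i
      · simp
      · simp)

/-- A colored permutation is a pair (color vector, permutation). -/
def equivProd (n p : ℕ) : (Fin n → ZMod p) × Equiv.Perm (Fin n) ≃ ColoredPerm n p where
  toFun a := ⟨a.1, a.2⟩
  invFun x := (x.color, x.perm)
  left_inv _ := rfl
  right_inv _ := rfl

instance [NeZero p] : Fintype (ColoredPerm n p) := Fintype.ofEquiv _ (equivProd n p)

/-- `A_u`: the colored permutations in which the largest `u` labels (those `i : Fin n` with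
`n - u ≤ i`) appear in increasing order of position and all have color `0`. -/
def frozen (n p u : ℕ) : Set (ColoredPerm n p) :=
  {x | (∀ i j : Fin n, n ≤ (i : ℕ) + u → i < j → x.perm⁻¹ i < x.perm⁻¹ j) ∧
       (∀ i : Fin n, n ≤ (i : ℕ) + u → x.color (x.perm⁻¹ i) = 0)}

end ColoredPerm

/-- The probability mass function of the uniform law on a finite nonempty set `A`. -/
noncomputable def uniformLaw {X : Type*} (A : Set X) : X → ℝ :=
  A.indicator fun _ => 1 / (A.ncard : ℝ)

/-- The convolution `(M * N)(z) = ∑ u, M (z u⁻¹) N u` on a finite group. -/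
def convLaw {X : Type*} [Group X] [Fintype X] (M N : X → ℝ) : X → ℝ :=
  fun z => ∑ u, M (z * u⁻¹) * N u

/-- The convolution power `Q^{*k}`, with `Q^{*0} = δ_e`. -/
noncomputable def convPower {X : Type*} [Group X] [Fintype X] (Q : X → ℝ) : ℕ → X → ℝ
  | 0 => Set.indicator {1} fun _ => 1
  | k + 1 => convLaw (convPower Q k) Q

/-- `sep(M, U) = 1 - min_x M(x) / U(x)`. -/
noncomputable def sep {X : Type*} [Fintype X] [Nonempty X] (M U : X → ℝ) : ℝ :=
  1 - Finset.univ.inf' Finset.univ_nonempty fun x => M x / U x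

/-- One step of colored top-`m`-to-random (`m ≤ n`): the uniform law `Q^{(m)}` on `A_{n-m}`. -/
noncomputable def topToRandom (n p m : ℕ) : ColoredPerm n p → ℝ :=
  uniformLaw (ColoredPerm.frozen n p (n - m))

/-- The separation `sep((Q^{(m)})^{*k}, U)` from the uniform law `U` after `k` steps. -/
noncomputable def topToRandomSep (n p m : ℕ) [NeZero p] (k : ℕ) : ℝ :=
  sep (convPower (topToRandom n p m) k) (uniformLaw (Set.univ : Set (ColoredPerm n p)))

/-- The separation mixing time `min {k ≥ 0 : sep((Q^{(m)})^{*k}, U) ≤ ε}`. -/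
noncomputable def sepMixingTime (n p m : ℕ) [NeZero p] (ε : ℝ) : ℕ :=
  sInf {k : ℕ | topToRandomSep n p m k ≤ ε}

/-! Write `B_a` for `freeIndicator n p a`; the step `Q^(m)` is `B_m` normalized. Undoing one
insertion of the top card gives `B_a * B_1 = a p B_a + B_{a+1}` for `a < n`, and `B_n * B_1 = n p
B_n` (`convLaw_freeIndicator_one`). So `B_a` is the product of the `B_1 - j p`, `j < a`: a
polynomial in `B_1` whose value at `i p` is `p^a i(i-1)⋯(i-a+1)`.

Hence `B_m^k = ∑ c_a B_a` with `c_a ≥ 0`. Here `B_n` is constantly 1, while every other `B_a`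
vanishes as soon as the last label has nonzero color, which is possible because `p ≥ 2`. The minimum
of `B_m^k` is therefore `c_n`, and an `n`-th finite difference of the polynomial values extracts it.
After normalization this is the inclusion-exclusion formula for the probability that `k` random
`m`-subsets cover `n` coupons (`topToRandomSep_succ`).

At `k ≈ (n/m)(log n + c)` this probability tends to `exp(-e^{-c})` (`tendsto_coverProb`). As
separation is nonincreasing in time, solving `1 - exp(-e^{-c}) = ε` locates the mixing time up to
`o(n)`. -/

namespace ColoredPerm

/-! ### The one-card step -/

section Insertion

variable {n p : ℕ}

theorem mem_frozen_sub {a : ℕ} (ha : a ≤ n) (x : ColoredPerm n p) :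
    x ∈ frozen n p (n - a) ↔
      (∀ i j : Fin n, a ≤ (i : ℕ) → i < j → x.perm⁻¹ i < x.perm⁻¹ j) ∧
        ∀ i : Fin n, a ≤ (i : ℕ) → x.color (x.perm⁻¹ i) = 0 := by
  have h (i : Fin n) : n ≤ (i : ℕ) + (n - a) ↔ a ≤ (i : ℕ) := by omega
  simp only [frozen, Set.mem_ofPred_eq, h]

/-- The shuffle that puts the top card, recolored by `c`, in position `t`. -/
def insertTop (t : Fin (n + 1)) (c : ZMod p) : ColoredPerm (n + 1) p :=
  ⟨Pi.single t c, Fin.cycleRange t⟩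

theorem insertTop_injective :
    Function.Injective fun q : Fin (n + 1) × ZMod p => insertTop q.1 q.2 := by
  rintro ⟨t, c⟩ ⟨t', c'⟩ h
  have hperm : Fin.cycleRange t = Fin.cycleRange t' := congrArg perm h
  have ht : t = t' := by
    have := congrArg (fun σ : Equiv.Perm (Fin (n + 1)) => σ.symm 0) hperm
    simpa using this
  subst ht
  have hcolor : (Pi.single t c : Fin (n + 1) → ZMod p) = Pi.single t c' := congrArg color h
  simpa using congrFun hcolor t

theorem cycleRange_lt_cycleRange {t s s' : Fin (n + 1)} (hs : s ≠ t) (hs' : s' ≠ t) :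
    Fin.cycleRange t s < Fin.cycleRange t s' ↔ s < s' := by
  obtain ⟨i, rfl⟩ := Fin.exists_succAbove_eq hs
  obtain ⟨j, rfl⟩ := Fin.exists_succAbove_eq hs'
  simp [Fin.cycleRange_succAbove]

theorem cycleRange_pos {t s : Fin (n + 1)} (hs : s ≠ t) : 0 < Fin.cycleRange t s := by
  obtain ⟨i, rfl⟩ := Fin.exists_succAbove_eq hs
  simp [Fin.cycleRange_succAbove]

/-- The positions of the nonzero labels form an increasing sequence that misses only the position
`t` of label `0`, so they are given by `t.succAbove`; the only other freedom is the color at `t`. -/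
theorem mem_frozen_iff_insertTop (y : ColoredPerm (n + 1) p) :
    y ∈ frozen (n + 1) p (n + 1 - 1) ↔ ∃ t c, insertTop t c = y := by
  rw [mem_frozen_sub (by omega)]
  constructor
  · rintro ⟨hinc, hcol⟩
    set t := y.perm⁻¹ 0 with ht
    have hmono : StrictMono fun i : Fin n => y.perm⁻¹ i.succ := fun i j hij =>
      hinc _ _ (by simp) (Fin.succ_lt_succ_iff.2 hij)
    have hrange : Set.range (fun i : Fin n => y.perm⁻¹ i.succ) = Set.range t.succAbove := by
      rw [Fin.range_succAbove]
      ext s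
      simp only [Set.mem_range, Set.mem_compl_iff, Set.mem_singleton_iff]
      constructor
      · rintro ⟨i, rfl⟩ h
        exact Fin.succ_ne_zero i (y.perm⁻¹.injective h)
      · intro h
        have : y.perm s ≠ 0 := fun h0 => h (by rw [ht, ← h0]; simp)
        obtain ⟨i, hi⟩ := Fin.exists_succ_eq.2 this
        exact ⟨i, by rw [hi]; simp⟩
    have hfun : (fun i : Fin n => y.perm⁻¹ i.succ) = t.succAbove :=
      hmono.range_inj (Fin.strictMono_succAbove t) |>.1 hrange
    have hperm : Fin.cycleRange t = y.perm := by
      have : (Fin.cycleRange t).symm = y.perm⁻¹ := by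
        ext1 i
        refine Fin.cases ?_ (fun i => ?_) i
        · simp [ht]
        · rw [Fin.cycleRange_symm_succ]
          exact (congrFun hfun i).symm
      rw [← inv_inv y.perm, ← this]
      rfl
    refine ⟨t, y.color t, ?_⟩
    ext1
    · funext s
      rcases eq_or_ne s t with rfl | hs
      · simp [insertTop]
      · have : y.perm s ≠ 0 := fun h0 => hs (by rw [ht, ← h0]; simp)
        have h := hcol (y.perm s) (Nat.one_le_iff_ne_zero.2 fun h0 => this (Fin.ext h0))
        simp only [insertTop, Pi.single_eq_of_ne hs]
        simpa using h.symm
    · exact hperm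
  · rintro ⟨t, c, rfl⟩
    have hinv : (insertTop t c : ColoredPerm (n + 1) p).perm⁻¹ = (Fin.cycleRange t).symm := rfl
    refine ⟨fun i j hi hij => ?_, fun i hi => ?_⟩
    · obtain ⟨i, rfl⟩ := Fin.exists_succ_eq.2 (show i ≠ 0 by rintro rfl; rw [Fin.val_zero] at hi; omega)
      obtain ⟨j, rfl⟩ := Fin.exists_succ_eq.2 (show j ≠ 0 by rintro rfl; exact absurd hij (Fin.not_lt_zero _))
      rw [hinv, Fin.cycleRange_symm_succ, Fin.cycleRange_symm_succ]
      exact Fin.strictMono_succAbove t (Fin.succ_lt_succ_iff.1 hij)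
    · obtain ⟨i, rfl⟩ := Fin.exists_succ_eq.2 (show i ≠ 0 by rintro rfl; rw [Fin.val_zero] at hi; omega)
      rw [hinv, Fin.cycleRange_symm_succ]
      simp [insertTop]

/-- Undoing the insertion moves label `l` to the front and subtracts `c` from its color. A free
label (`l < a`) can be moved without affecting the frozen ones. Label `a` at the front precedes all
larger ones automatically, so only its color is constrained. A label beyond `a` would end up before
`a`. -/
theorem mul_insertTop_inv_mem_frozen {a : ℕ} (ha : a ≤ n + 1) (z : ColoredPerm (n + 1) p)
    (l : Fin (n + 1)) (c : ZMod p) :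
    z * (insertTop (z.perm⁻¹ l) c)⁻¹ ∈ frozen (n + 1) p (n + 1 - a) ↔
      ((l : ℕ) < a ∧ z ∈ frozen (n + 1) p (n + 1 - a)) ∨
        ((l : ℕ) = a ∧ c = z.color (z.perm⁻¹ l) ∧ z ∈ frozen (n + 1) p (n + 1 - (a + 1))) := by
  set t := z.perm⁻¹ l with ht
  have hne {i : Fin (n + 1)} (h : i ≠ l) : z.perm⁻¹ i ≠ t := fun h' => h (z.perm⁻¹.injective h')
  have hpinv (i : Fin (n + 1)) :
      (z * (insertTop t c)⁻¹).perm⁻¹ i = Fin.cycleRange t (z.perm⁻¹ i) := by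
    simp [insertTop]
  have hcol (i : Fin (n + 1)) :
      (z * (insertTop t c)⁻¹).color (Fin.cycleRange t (z.perm⁻¹ i)) =
        z.color (z.perm⁻¹ i) - (Pi.single t c : Fin (n + 1) → ZMod p) (z.perm⁻¹ i) := by
    simp [insertTop, sub_eq_add_neg]
  rw [mem_frozen_sub ha]
  simp only [hpinv, hcol, sub_eq_zero]
  rcases lt_trichotomy (l : ℕ) a with hl | hl | hl
  · have hi {i : Fin (n + 1)} (h : a ≤ (i : ℕ)) : i ≠ l := by rintro rfl; omega
    simp only [hl, hl.ne, true_and, false_and, or_false]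
    rw [mem_frozen_sub ha]
    refine and_congr ?_ ?_
    · refine forall₄_congr fun i j h hij => ?_
      exact cycleRange_lt_cycleRange (hne (hi h)) (hne (hi (h.trans (le_of_lt hij))))
    · refine forall₂_congr fun i h => ?_
      rw [Pi.single_eq_of_ne (hne (hi h))]
  · have ha' : a + 1 ≤ n + 1 := by omega
    simp only [hl, lt_irrefl, true_and, false_and, false_or]
    rw [mem_frozen_sub ha']
    constructor
    · rintro ⟨h1, h2⟩
      have hc := h2 l hl.ge
      rw [← ht, Pi.single_eq_same] at hc
      have hi {i : Fin (n + 1)} (h : a + 1 ≤ (i : ℕ)) : i ≠ l := by rintro rfl; omega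
      refine ⟨hc.symm, fun i j h hij => ?_, fun i h => ?_⟩
      · exact (cycleRange_lt_cycleRange (hne (hi h)) (hne (hi (h.trans (le_of_lt hij))))).1
          (h1 i j (by omega) hij)
      · have := h2 i (by omega)
        rwa [Pi.single_eq_of_ne (hne (hi h))] at this
    · rintro ⟨hc, h1, h2⟩
      refine ⟨fun i j h hij => ?_, fun i h => ?_⟩
      · have hj : j ≠ l := by rintro rfl; have := Fin.lt_def.1 hij; omega
        rcases eq_or_ne i l with rfl | hi
        · rw [← ht, Fin.cycleRange_self]
          exact cycleRange_pos (hne hj)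
        · have : (i : ℕ) ≠ l := fun h' => hi (Fin.ext h')
          exact (cycleRange_lt_cycleRange (hne hi) (hne hj)).2 (h1 i j (by omega) hij)
      · rcases eq_or_ne i l with rfl | hi
        · rw [← ht, Pi.single_eq_same, hc]
        · have : (i : ℕ) ≠ l := fun h' => hi (Fin.ext h')
          rw [Pi.single_eq_of_ne (hne hi)]
          exact h2 i (by omega)
  · simp only [hl.not_gt, hl.ne', false_and, or_false, iff_false]
    rintro ⟨h1, -⟩
    have hal : a < n + 1 := by omega
    have := h1 ⟨a, hal⟩ l le_rfl (Fin.lt_def.2 hl)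
    rw [← ht, Fin.cycleRange_self] at this
    exact absurd this (by simp)

end Insertion

/-- The indicator function of the colored permutations whose labels `i ≥ a` are frozen. -/
noncomputable def freeIndicator (n p a : ℕ) : ColoredPerm n p → ℝ :=
  (frozen n p (n - a)).indicator 1

theorem freeIndicator_nonneg (n p a : ℕ) (x : ColoredPerm n p) : 0 ≤ freeIndicator n p a x :=
  Set.indicator_nonneg (fun _ _ => zero_le_one) x

theorem freeIndicator_self (n p : ℕ) : freeIndicator n p n = 1 := by
  have : frozen n p (n - n) = Set.univ := by
    ext x
    rw [mem_frozen_sub le_rfl]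
    simp only [Set.mem_univ, iff_true]
    exact ⟨fun i _ h => absurd i.2 (by omega), fun i h => absurd i.2 (by omega)⟩
  rw [freeIndicator, this, Set.indicator_univ]

theorem frozen_self (n p : ℕ) : frozen n p n = {1} := by
  have h := mem_frozen_sub (n := n) (p := p) (Nat.zero_le n)
  simp only [Nat.sub_zero, Nat.zero_le, forall_const] at h
  ext x
  rw [h, Set.mem_singleton_iff]
  constructor
  · rintro ⟨hinc, hcol⟩
    have hmono : StrictMono (x.perm⁻¹ : Equiv.Perm (Fin n)) := fun i j hij => hinc i j hij
    have hid : ⇑(x.perm⁻¹ : Equiv.Perm (Fin n)) = id := by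
      refine hmono.range_inj strictMono_id |>.1 ?_
      rw [(x.perm⁻¹).surjective.range_eq, Set.range_id]
    have hperm : x.perm = 1 := by
      rw [← inv_eq_one]
      ext1 i
      exact congrFun hid i
    ext1
    · funext i
      have := hcol i
      rw [hperm] at this
      simpa using this
    · exact hperm
  · rintro rfl
    simp

/-- If any label is frozen, the last one is. Such an `x` is where the separation is attained. -/
theorem freeIndicator_eq_zero {n p a : ℕ} (ha : a < n) (x : ColoredPerm n p)
    (hx : x.color (x.perm⁻¹ ⟨n - 1, by omega⟩) ≠ 0) : freeIndicator n p a x = 0 := by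
  refine Set.indicator_of_notMem (fun h => hx ?_) _
  rw [mem_frozen_sub ha.le] at h
  exact h.2 _ (by simp; omega)

/-- One step of the top-to-random shuffle with recoloring. -/
theorem convLaw_freeIndicator_one {n p : ℕ} [NeZero p] (hn : 1 ≤ n) {a : ℕ} (ha : a ≤ n) :
    convLaw (freeIndicator n p a) (freeIndicator n p 1) =
      ((a * p : ℕ) : ℝ) • freeIndicator n p a +
        if a < n then freeIndicator n p (a + 1) else 0 := by
  classical
  obtain ⟨n, rfl⟩ : ∃ k, n = k + 1 := ⟨n - 1, by omega⟩
  funext z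
  have hsum (F : ColoredPerm (n + 1) p → ℝ) :
      ∑ y, F y * freeIndicator (n + 1) p 1 y =
        ∑ t : Fin (n + 1), ∑ c : ZMod p, F (insertTop t c) := by
    have h1 (y : ColoredPerm (n + 1) p) : F y * freeIndicator (n + 1) p 1 y =
        if ∃ t c, insertTop t c = y then F y else 0 := by
      simp only [freeIndicator, Set.indicator_apply, mem_frozen_iff_insertTop, Pi.one_apply,
        mul_ite, mul_one, mul_zero]
    rw [← Fintype.sum_prod_type' (fun t c => F (insertTop t c)),
      ← Finset.sum_image (f := F) (s := Finset.univ)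
        (g := fun q : Fin (n + 1) × ZMod p => insertTop q.1 q.2) insertTop_injective.injOn,
      Finset.sum_congr rfl fun y _ => h1 y, ← Finset.sum_filter]
    congr 1
    ext y
    simp
  -- The insertion position is indexed by the label that `z` carries there.
  rw [convLaw, hsum, ← Equiv.sum_comp (z.perm⁻¹)]
  set A : ℝ := freeIndicator (n + 1) p a z with hA
  set B : ℝ := freeIndicator (n + 1) p (a + 1) z with hB
  have hterm (l : Fin (n + 1)) (c : ZMod p) :
      freeIndicator (n + 1) p a (z * (insertTop (z.perm⁻¹ l) c)⁻¹) =
        (if (l : ℕ) < a then A else 0) +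
          if (l : ℕ) = a then (if c = z.color (z.perm⁻¹ l) then B else 0) else 0 := by
    simp only [hA, hB, freeIndicator, Set.indicator_apply, mul_insertTop_inv_mem_frozen ha,
      Pi.one_apply]
    rcases lt_trichotomy (l : ℕ) a with h | h | h
    · simp [h, h.ne]
    · simp [h, ite_and]
    · simp [h.not_gt, h.ne']
  have hcard : Fintype.card (ZMod p) = p := ZMod.card p
  simp only [hterm, Finset.sum_add_distrib, Finset.sum_const, Finset.card_univ, hcard,
    Finset.sum_ite_irrel, Finset.sum_ite_eq', Finset.mem_univ, if_true, smul_zero]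
  have hlt : ∑ l : Fin (n + 1), p • (if (l : ℕ) < a then A else 0) = ((a * p : ℕ) : ℝ) * A := by
    rw [← Finset.smul_sum, ← Finset.sum_filter, Finset.sum_const, Fin.card_filter_val_lt,
      min_eq_right ha]
    simp only [nsmul_eq_mul]
    push_cast
    ring
  have heq : ∑ l : Fin (n + 1), (if (l : ℕ) = a then B else 0) = if a < n + 1 then B else 0 := by
    split_ifs with h
    · rw [Finset.sum_eq_single ⟨a, h⟩]
      · simp
      · intro l _ hl
        rw [if_neg fun h' => hl (Fin.ext h')]
      · simp
    · exact Finset.sum_eq_zero fun l _ => if_neg (by omega)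
  rw [hlt, heq]
  simp only [Pi.add_apply, Pi.smul_apply, smul_eq_mul]
  congr 1
  split_ifs <;> rfl

end ColoredPerm
open scoped NNReal

/-! ### Convolution -/

section Convolution

variable {X : Type*} [Group X] [Fintype X]

theorem convLaw_assoc (L M N : X → ℝ) :
    convLaw (convLaw L M) N = convLaw L (convLaw M N) := by
  funext z
  simp only [convLaw, Finset.sum_mul, Finset.mul_sum]
  have h (u : X) : ∑ v, L (z * u⁻¹ * v⁻¹) * M v * N u =
      ∑ w, L (z * w⁻¹) * (M (w * u⁻¹) * N u) := by
    rw [← Equiv.sum_comp (Equiv.mulRight u⁻¹)]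
    refine Finset.sum_congr rfl fun w _ => ?_
    simp [mul_assoc]
  rw [Finset.sum_congr rfl fun u _ => h u, Finset.sum_comm]

theorem convLaw_add_left (L M N : X → ℝ) : convLaw (L + M) N = convLaw L N + convLaw M N := by
  funext z
  simp [convLaw, add_mul, Finset.sum_add_distrib]

theorem convLaw_sub_right (L M N : X → ℝ) : convLaw L (M - N) = convLaw L M - convLaw L N := by
  funext z
  simp [convLaw, mul_sub, Finset.sum_sub_distrib]

theorem convLaw_smul_left (c : ℝ) (M N : X → ℝ) : convLaw (c • M) N = c • convLaw M N := by
  funext z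
  simp [convLaw, Finset.mul_sum, mul_assoc]

theorem convLaw_smul_right (c : ℝ) (M N : X → ℝ) : convLaw M (c • N) = c • convLaw M N := by
  funext z
  simp [convLaw, Finset.mul_sum, mul_left_comm]

theorem convLaw_indicator_one (M : X → ℝ) : convLaw M (Set.indicator {1} fun _ => 1) = M := by
  classical
  funext z
  simp [convLaw, Set.indicator_apply]

theorem indicator_one_convLaw (M : X → ℝ) : convLaw (Set.indicator {1} fun _ => 1) M = M := by
  classical
  funext z
  rw [convLaw, Finset.sum_eq_single z]
  · simp
  · intro y _ hy
    have : z * y⁻¹ ∉ ({1} : Set X) := fun h => hy (mul_inv_eq_one.1 h).symm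
    rw [Set.indicator_of_notMem this, zero_mul]
  · simp

theorem convPower_smul (c : ℝ) (Q : X → ℝ) (k : ℕ) :
    convPower (c • Q) k = c ^ k • convPower Q k := by
  induction k with
  | zero => simp [convPower]
  | succ k ih =>
    rw [convPower, convPower, ih, convLaw_smul_left, convLaw_smul_right, smul_smul, pow_succ]

theorem le_convLaw {M Q : X → ℝ} (hQ : ∀ x, 0 ≤ Q x) (hQ1 : ∑ x, Q x = 1) {r : ℝ}
    (hM : ∀ x, r ≤ M x) (z : X) : r ≤ convLaw M Q z := by
  calc r = ∑ u, r * Q u := by rw [← Finset.mul_sum, hQ1, mul_one]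
    _ ≤ _ := Finset.sum_le_sum fun u _ => mul_le_mul_of_nonneg_right (hM _) (hQ u)

/-- Separation from the uniform law decreases along a random walk. -/
theorem sep_convLaw_le {M Q : X → ℝ} (hQ : ∀ x, 0 ≤ Q x) (hQ1 : ∑ x, Q x = 1) :
    sep (convLaw M Q) (uniformLaw (Set.univ : Set X)) ≤
      sep M (uniformLaw (Set.univ : Set X)) := by
  unfold sep
  refine sub_le_sub_left (Finset.le_inf' _ _ fun z _ => ?_) 1
  have hc : (0 : ℝ) < 1 / ((Set.univ : Set X).ncard : ℝ) := by
    rw [Set.ncard_univ]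
    have : 0 < Nat.card X := Nat.card_pos
    positivity
  have hU (x : X) : uniformLaw (Set.univ : Set X) x = 1 / ((Set.univ : Set X).ncard : ℝ) := by
    simp [uniformLaw]
  simp only [hU]
  rw [le_div_iff₀ hc]
  refine le_convLaw hQ hQ1 (fun x => ?_) z
  rw [← le_div_iff₀ hc]
  exact Finset.inf'_le _ (Finset.mem_univ x)

end Convolution

/-! ### Uniform laws and a finite-difference identity. -/

theorem uniformLaw_nonneg {X : Type*} (A : Set X) (x : X) : 0 ≤ uniformLaw A x :=
  Set.indicator_nonneg (fun _ _ => by positivity) x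

theorem ncard_eq_sum_indicator {X : Type*} [Fintype X] (A : Set X) :
    (A.ncard : ℝ) = ∑ x, A.indicator (1 : X → ℝ) x := by
  classical
  simp [Set.indicator_apply, Set.ncard_eq_toFinset_card']

theorem uniformLaw_eq_smul {X : Type*} (A : Set X) :
    uniformLaw A = (1 / (A.ncard : ℝ)) • A.indicator 1 := by
  classical
  funext x
  simp [uniformLaw, Set.indicator_apply]

theorem sum_uniformLaw {X : Type*} [Fintype X] {A : Set X} (hA : A.Nonempty) :
    ∑ x, uniformLaw A x = 1 := by
  have : (A.ncard : ℝ) ≠ 0 := by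
    exact_mod_cast (Set.ncard_pos (Set.toFinite A)).2 hA |>.ne'
  simp only [uniformLaw_eq_smul, Pi.smul_apply, smul_eq_mul, ← Finset.mul_sum,
    ← ncard_eq_sum_indicator]
  field_simp

/-- An `n`-th finite difference kills polynomials of degree below `n`. Concretely, trading the two
binomials turns the sum into a multiple of `(1 - 1)^(n - a)`. -/
theorem alternating_sum_choose_mul_descFactorial {n a : ℕ} (ha : a ≤ n) :
    ∑ j ∈ Finset.range (n + 1),
        (-1 : ℝ) ^ j * (n.choose j : ℝ) * ((n - j).descFactorial a : ℝ) =
      if a = n then (n.factorial : ℝ) else 0 := by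
  have h (j : ℕ) (hj : j ∈ Finset.range (n + 1)) :
      (-1 : ℝ) ^ j * (n.choose j : ℝ) * ((n - j).descFactorial a : ℝ) =
        (n.descFactorial a : ℝ) * (((-1) ^ j * ((n - a).choose j : ℤ) : ℤ) : ℝ) := by
    have key : n.choose j * (n - j).descFactorial a = n.descFactorial a * (n - a).choose j := by
      have hjn : j ≤ n := by simpa [Nat.lt_succ_iff] using hj
      have e1 : (n - j).descFactorial a = a.factorial * (n - j).choose a :=
        Nat.descFactorial_eq_factorial_mul_choose _ _
      have e2 : n.descFactorial a = a.factorial * n.choose a :=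
        Nat.descFactorial_eq_factorial_mul_choose _ _
      rw [e1, e2]
      have e3 : n.choose j * (n - j).choose a = n.choose a * (n - a).choose j := by
        rcases le_or_gt (a + j) n with h | h
        · have h1 := Nat.choose_mul (n := n) (k := a + j) (s := j) (by omega)
          have h2 := Nat.choose_mul (n := n) (k := a + j) (s := a) (by omega)
          rw [Nat.add_sub_cancel] at h1
          rw [Nat.add_sub_cancel_left] at h2
          rw [← h1, ← h2, Nat.choose_symm_add]
        · rw [Nat.choose_eq_zero_of_lt (show n - j < a by omega),
            Nat.choose_eq_zero_of_lt (show n - a < j by omega), mul_zero, mul_zero]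
      calc n.choose j * (a.factorial * (n - j).choose a)
          = a.factorial * (n.choose j * (n - j).choose a) := by ring
        _ = _ := by rw [e3]; ring
    push_cast
    rw [mul_assoc, ← Nat.cast_mul, key]
    push_cast
    ring
  rw [Finset.sum_congr rfl h, ← Finset.mul_sum, ← Int.cast_sum]
  have hsub : ∑ j ∈ Finset.range (n + 1), ((-1) ^ j * ((n - a).choose j : ℤ) : ℤ) =
      ∑ j ∈ Finset.range (n - a + 1), ((-1) ^ j * ((n - a).choose j : ℤ) : ℤ) := by
    symm
    refine Finset.sum_subset (Finset.range_mono (by omega)) fun j _ hj => ?_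
    rw [Nat.choose_eq_zero_of_lt (by simpa using hj)]
    simp
  rw [hsub, Int.alternating_sum_range_choose]
  rcases eq_or_ne a n with rfl | hne
  · simp [Nat.descFactorial_self]
  · rw [if_neg (by omega), if_neg hne]
    simp

namespace ColoredPerm

/-! ### Spectral description of the shuffle -/

section Cone

variable {n p : ℕ}

/-- An indicator of a set of colored permutations with `a` free labels, paired with the values of
its eigenvalue polynomial. -/
noncomputable def spectralPair (n p a : ℕ) : (ColoredPerm n p → ℝ) × (ℕ → ℝ) :=
  (freeIndicator n p a, fun i : ℕ => (p : ℝ) ^ a * (i.descFactorial a : ℝ))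

/-- Nonnegative combinations of the pairs with at least `m` free labels. -/
noncomputable def spectralCone (n p m : ℕ) : Submodule ℝ≥0 ((ColoredPerm n p → ℝ) × (ℕ → ℝ)) :=
  Submodule.span ℝ≥0 (spectralPair n p '' Set.Icc m n)

variable {m : ℕ} {M : ColoredPerm n p → ℝ} {w : ℕ → ℝ}

/-- Each generator is minimal at `x₀`: it vanishes there or is constant. Nonnegative combinations
preserve this. -/
theorem apply_le_of_mem_spectralCone (hn : 1 ≤ n) (h : (M, w) ∈ spectralCone n p m)
    {x₀ : ColoredPerm n p} (hx₀ : x₀.color (x₀.perm⁻¹ ⟨n - 1, by omega⟩) ≠ 0)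
    (x : ColoredPerm n p) : M x₀ ≤ M x := by
  suffices H : ∀ q ∈ spectralCone n p m, q.1 x₀ ≤ q.1 x from H _ h
  intro q hq
  induction hq using Submodule.span_induction with
  | mem q hq =>
    obtain ⟨a, ha, rfl⟩ := hq
    rcases ha.2.lt_or_eq with h | rfl
    · exact (freeIndicator_eq_zero h x₀ hx₀).trans_le (freeIndicator_nonneg _ _ _ _)
    · simp [spectralPair, freeIndicator_self]
  | zero => simp
  | add q r _ _ hq hr => exact add_le_add hq hr
  | smul c q _ hq => exact mul_le_mul_of_nonneg_left hq c.2

/-- Both sides are linear in the pair, and on generators both vanish for `a < n` and equal `p^n n!`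
for `a = n`. Carrying `w` along with `M` avoids naming the coefficients. -/
theorem apply_eq_of_mem_spectralCone (hn : 1 ≤ n) (h : (M, w) ∈ spectralCone n p m)
    {x₀ : ColoredPerm n p} (hx₀ : x₀.color (x₀.perm⁻¹ ⟨n - 1, by omega⟩) ≠ 0) :
    (p : ℝ) ^ n * (n.factorial : ℝ) * M x₀ =
      ∑ j ∈ Finset.range (n + 1), (-1 : ℝ) ^ j * (n.choose j : ℝ) * w (n - j) := by
  suffices H : ∀ q ∈ spectralCone n p m, (p : ℝ) ^ n * (n.factorial : ℝ) * q.1 x₀ =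
      ∑ j ∈ Finset.range (n + 1), (-1 : ℝ) ^ j * (n.choose j : ℝ) * q.2 (n - j) from H _ h
  intro q hq
  induction hq using Submodule.span_induction with
  | mem q hq =>
    obtain ⟨a, ha, rfl⟩ := hq
    have e : ∑ j ∈ Finset.range (n + 1), (-1 : ℝ) ^ j * (n.choose j : ℝ) *
        ((p : ℝ) ^ a * ((n - j).descFactorial a : ℝ)) =
        (p : ℝ) ^ a * if a = n then (n.factorial : ℝ) else 0 := by
      rw [← alternating_sum_choose_mul_descFactorial ha.2, Finset.mul_sum]
      exact Finset.sum_congr rfl fun j _ => by ring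
    simp only [spectralPair, e]
    rcases ha.2.lt_or_eq with h | rfl
    · rw [freeIndicator_eq_zero h x₀ hx₀, if_neg h.ne]
      simp
    · simp [freeIndicator_self]
  | zero => simp
  | add q r _ _ hq hr =>
    simp only [Prod.fst_add, Prod.snd_add, Pi.add_apply, mul_add, hq, hr, Finset.sum_add_distrib]
  | smul c q _ hq =>
    simp only [Prod.smul_fst, Prod.smul_snd, Pi.smul_apply, NNReal.smul_def, smul_eq_mul]
    rw [mul_left_comm, hq, Finset.mul_sum]
    exact Finset.sum_congr rfl fun j _ => by ring

/-- The cone is stable under `T - j p`, `j ≤ m`, with `T` the one-card step; the weights are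
controlled only at `i ≤ n`. -/
theorem spectralCone_step [NeZero p] (hn : 1 ≤ n) {j : ℕ} (hj : j ≤ m)
    (h : (M, w) ∈ spectralCone n p m) :
    ∃ w', (∀ i ≤ n, w' i = (((i : ℝ) - j) * p) * w i) ∧
      (convLaw M (freeIndicator n p 1) - ((j * p : ℕ) : ℝ) • M, w') ∈ spectralCone n p m := by
  suffices H : ∀ q ∈ spectralCone n p m, ∃ w', (∀ i ≤ n, w' i = (((i : ℝ) - j) * p) * q.2 i) ∧
      (convLaw q.1 (freeIndicator n p 1) - ((j * p : ℕ) : ℝ) • q.1, w') ∈ spectralCone n p m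
    from H _ h
  intro q hq
  induction hq using Submodule.span_induction with
  | mem q hq =>
    obtain ⟨a, ha, rfl⟩ := hq
    have hdesc (i : ℕ) : ((i.descFactorial (a + 1) : ℕ) : ℝ) =
        ((i : ℝ) - a) * (i.descFactorial a : ℝ) := by
      rcases le_or_gt a i with hi | hi
      · rw [Nat.descFactorial_succ, Nat.cast_mul, Nat.cast_sub hi]
      · rw [Nat.descFactorial_of_lt (by omega : i < a + 1), Nat.descFactorial_of_lt hi]
        simp
    -- Positivity of the new coefficient `(a - j) p` rests on `j ≤ m ≤ a`.
    have hc : (((a - j) * p : ℕ) : ℝ≥0) • spectralPair n p a ∈ spectralCone n p m :=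
      Submodule.smul_mem _ _ (Submodule.subset_span ⟨a, ha, rfl⟩)
    have hja : j ≤ a := hj.trans ha.1
    have hcast : (((a - j) * p : ℕ) : ℝ) = ((a : ℝ) - j) * p := by
      rw [Nat.cast_mul, Nat.cast_sub hja]
    rcases ha.2.lt_or_eq with han | rfl
    · have hs : spectralPair n p (a + 1) ∈ spectralCone n p m :=
        Submodule.subset_span ⟨a + 1, ⟨by have := ha.1; omega, han⟩, rfl⟩
      have hadd := Submodule.add_mem _ hc hs
      refine ⟨((((a - j) * p : ℕ) : ℝ≥0) • spectralPair n p a + spectralPair n p (a + 1)).2,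
        ?_, ?_⟩
      rotate_left
      · convert hadd using 1
        refine Prod.ext ?_ rfl
        simp only [spectralPair, Prod.fst_add, Prod.smul_fst, NNReal.smul_def, NNReal.coe_natCast]
        rw [convLaw_freeIndicator_one hn ha.2, if_pos han, hcast]
        funext x
        simp only [Pi.sub_apply, Pi.add_apply, Pi.smul_apply, smul_eq_mul]
        push_cast
        ring
      · intro i _
        simp only [spectralPair, Prod.snd_add, Prod.smul_snd, Pi.add_apply, Pi.smul_apply, NNReal.smul_def,
          NNReal.coe_natCast, smul_eq_mul, hdesc, hcast]
        ring
    -- With no label left to free, the step multiplies by `(n - j) p`. This agrees with `(i - j) p`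
    -- at `i = n`, and for `i < n` the falling factorial is zero; for `i > n` it would fail.
    · refine ⟨((((a - j) * p : ℕ) : ℝ≥0) • spectralPair a p a).2, ?_, ?_⟩
      rotate_left
      · convert hc using 1
        refine Prod.ext ?_ rfl
        simp only [spectralPair, Prod.smul_fst, NNReal.smul_def, NNReal.coe_natCast]
        rw [convLaw_freeIndicator_one hn le_rfl, if_neg (lt_irrefl _), hcast]
        funext x
        simp only [Pi.sub_apply, Pi.add_apply, Pi.smul_apply, smul_eq_mul, Pi.zero_apply]
        push_cast
        ring
      · intro i hi
        simp only [spectralPair, Prod.smul_snd, Pi.smul_apply, NNReal.smul_def,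
          NNReal.coe_natCast, smul_eq_mul, hcast]
        rcases hi.lt_or_eq with hi | rfl
        · rw [Nat.descFactorial_of_lt hi]
          simp
        · ring
  | zero =>
    refine ⟨0, by simp, ?_⟩
    convert Submodule.zero_mem _ using 1
    refine Prod.ext ?_ rfl
    funext x
    simp [convLaw]
  | add q r _ _ hq hr =>
    obtain ⟨v, hv, hv'⟩ := hq
    obtain ⟨u, hu, hu'⟩ := hr
    refine ⟨v + u, fun i hi => ?_, ?_⟩
    · rw [Pi.add_apply, hv i hi, hu i hi, Prod.snd_add, Pi.add_apply, mul_add]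
    · convert Submodule.add_mem _ hv' hu' using 1
      refine Prod.ext ?_ rfl
      simp only [Prod.fst_add, convLaw_add_left, smul_add]
      abel
  | smul c q _ hq =>
    obtain ⟨v, hv, hv'⟩ := hq
    refine ⟨c • v, fun i hi => ?_, ?_⟩
    · rw [Pi.smul_apply, hv i hi, Prod.smul_snd, Pi.smul_apply]
      simp only [NNReal.smul_def, smul_eq_mul]
      ring
    · convert Submodule.smul_mem _ c hv' using 1
      refine Prod.ext ?_ rfl
      simp only [Prod.smul_fst, NNReal.smul_def, convLaw_smul_left, smul_sub]
      rw [smul_comm]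

/-! ### Convolution powers in the cone, and total masses. -/

theorem freeIndicator_zero : freeIndicator n p 0 = Set.indicator {1} fun _ => 1 := by
  rw [freeIndicator, Nat.sub_zero, frozen_self]
  rfl

/-- The one-card recurrence solved for its last term, so that a batch of cards is handled one card
at a time. -/
theorem convLaw_freeIndicator_succ [NeZero p] {a : ℕ} (ha : a < n) (M : ColoredPerm n p → ℝ) :
    convLaw M (freeIndicator n p (a + 1)) =
      convLaw (convLaw M (freeIndicator n p a)) (freeIndicator n p 1) -
        ((a * p : ℕ) : ℝ) • convLaw M (freeIndicator n p a) := by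
  have h := convLaw_freeIndicator_one (p := p) (by omega : 1 ≤ n) ha.le
  rw [if_pos ha] at h
  rw [eq_sub_of_add_eq' h.symm, convLaw_sub_right, convLaw_assoc, convLaw_smul_right]

theorem spectralCone_convLaw [NeZero p] (hn : 1 ≤ n) (hmn : m ≤ n)
    (h : (M, w) ∈ spectralCone n p m) {j : ℕ} (hj : j ≤ m) :
    ∃ w', (∀ i ≤ n, w' i = ((p : ℝ) ^ j * (i.descFactorial j : ℝ)) * w i) ∧
      (convLaw M (freeIndicator n p j), w') ∈ spectralCone n p m := by
  induction j with
  | zero => exact ⟨w, by simp, by rwa [freeIndicator_zero, convLaw_indicator_one]⟩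
  | succ j ih =>
    obtain ⟨v, hv, hv'⟩ := ih (by omega)
    obtain ⟨u, hu, hu'⟩ := spectralCone_step hn (by omega : j ≤ m) hv'
    refine ⟨u, fun i hi => ?_, ?_⟩
    · rw [hu i hi, hv i hi]
      rcases le_or_gt j i with hij | hij
      · rw [Nat.descFactorial_succ, Nat.cast_mul, Nat.cast_sub hij]
        ring
      · rw [Nat.descFactorial_of_lt (by omega : i < j + 1), Nat.descFactorial_of_lt hij]
        simp
    · rwa [convLaw_freeIndicator_succ (by omega)]

/-- The powers start at 1: the zeroth one, `freeIndicator n p 0`, is not a generator once `m ≥ 1`.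
-/
theorem convPower_mem_spectralCone [NeZero p] (hn : 1 ≤ n) (hmn : m ≤ n) (k : ℕ) :
    ∃ w, (∀ i ≤ n, w i = ((p : ℝ) ^ m * (i.descFactorial m : ℝ)) ^ (k + 1)) ∧
      (convPower (freeIndicator n p m) (k + 1), w) ∈ spectralCone n p m := by
  induction k with
  | zero =>
    refine ⟨fun i => (p : ℝ) ^ m * (i.descFactorial m : ℝ), by simp, ?_⟩
    rw [convPower, convPower, indicator_one_convLaw]
    exact Submodule.subset_span ⟨m, ⟨le_rfl, hmn⟩, rfl⟩
  | succ k ih =>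
    obtain ⟨v, hv, hv'⟩ := ih
    obtain ⟨u, hu, hu'⟩ := spectralCone_convLaw hn hmn hv' le_rfl
    refine ⟨u, fun i hi => ?_, hu'⟩
    rw [hu i hi, hv i hi]
    ring

theorem sum_convLaw [NeZero p] (M N : ColoredPerm n p → ℝ) :
    ∑ x, convLaw M N x = (∑ x, M x) * ∑ x, N x := by
  simp only [convLaw]
  rw [Finset.sum_comm, Finset.mul_sum]
  refine Finset.sum_congr rfl fun u _ => ?_
  rw [← Finset.sum_mul]
  congr 1
  exact Equiv.sum_comp (Equiv.mulRight u⁻¹) M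

theorem sum_freeIndicator [NeZero p] {a : ℕ} (ha : a ≤ n) :
    ∑ x, freeIndicator n p a x = (p : ℝ) ^ a * (n.descFactorial a : ℝ) := by
  induction a with
  | zero =>
    classical
    rw [freeIndicator_zero]
    simp [Set.indicator_apply]
  | succ a ih =>
    have hn : 1 ≤ n := by omega
    -- Convolving the constant `1 = freeIndicator n p n` with a function returns its total mass.
    have h1 : ∑ x, freeIndicator n p 1 x = (n : ℝ) * p := by
      have := congrFun (convLaw_freeIndicator_one (p := p) hn le_rfl) 1
      simpa [freeIndicator_self, convLaw] using this
    have h := congrArg (fun M : ColoredPerm n p → ℝ => ∑ x, M x)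
      (convLaw_freeIndicator_one (p := p) hn (by omega : a ≤ n))
    simp only [sum_convLaw, if_pos (show a < n by omega), Pi.add_apply,
      Finset.sum_add_distrib, Pi.smul_apply, smul_eq_mul, ← Finset.mul_sum, h1,
      ih (by omega)] at h
    rw [Nat.descFactorial_succ, Nat.cast_mul, Nat.cast_sub (by omega : a ≤ n)]
    push_cast at h ⊢
    linear_combination -h

end Cone

end ColoredPerm

/-! ### The separation formula -/

/-- The probability that `k` batches of `m` distinct coupons out of `n` contain all of them. -/
noncomputable def coverProb (n m k : ℕ) : ℝ :=
  ∑ j ∈ Finset.range (n + 1), (-1 : ℝ) ^ j * (n.choose j : ℝ) *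
    (((n - j).descFactorial m : ℝ) / (n.descFactorial m : ℝ)) ^ k

open ColoredPerm in
theorem topToRandomSep_succ {n p m : ℕ} [NeZero p] (hp : 2 ≤ p) (hn : 1 ≤ n) (hmn : m ≤ n)
    (k : ℕ) : topToRandomSep n p m (k + 1) = 1 - coverProb n m (k + 1) := by
  have hp0 : (p : ℝ) ≠ 0 := Nat.cast_ne_zero.2 (NeZero.ne p)
  have hU (x : ColoredPerm n p) : uniformLaw (Set.univ : Set (ColoredPerm n p)) x =
      1 / ((p : ℝ) ^ n * (n.factorial : ℝ)) := by
    rw [uniformLaw_eq_smul, ncard_eq_sum_indicator]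
    have := sum_freeIndicator (n := n) (p := p) le_rfl
    rw [freeIndicator_self, Nat.descFactorial_self] at this
    simp only [Set.indicator_univ, this]
    simp
  have hQ : topToRandom n p m =
      (1 / ((p : ℝ) ^ m * (n.descFactorial m : ℝ))) • freeIndicator n p m := by
    rw [topToRandom, uniformLaw_eq_smul, ncard_eq_sum_indicator, ← sum_freeIndicator hmn]
    rfl
  have hfac : (n.factorial : ℝ) ≠ 0 := Nat.cast_ne_zero.2 (Nat.factorial_ne_zero n)
  have hdesc : (n.descFactorial m : ℝ) ≠ 0 := by
    rw [Nat.cast_ne_zero]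
    exact fun h => absurd (Nat.descFactorial_eq_zero_iff_lt.1 h) (by omega)
  have : Fact (1 < p) := ⟨by omega⟩
  -- The minimizer: every color is 1, which is nonzero in `ZMod p` as `p ≥ 2`.
  let x₀ : ColoredPerm n p := ⟨1, 1⟩
  have hx₀ : x₀.color (x₀.perm⁻¹ ⟨n - 1, by omega⟩) ≠ 0 := by
    simp [x₀]
  obtain ⟨w, hw, hmem⟩ := convPower_mem_spectralCone (n := n) (p := p) (m := m) hn hmn k
  have hc : 0 ≤ (1 / ((p : ℝ) ^ m * (n.descFactorial m : ℝ))) ^ (k + 1) := by positivity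
  have hval : (1 / ((p : ℝ) ^ m * (n.descFactorial m : ℝ))) ^ (k + 1) *
      convPower (freeIndicator n p m) (k + 1) x₀ /
        (1 / ((p : ℝ) ^ n * (n.factorial : ℝ))) = coverProb n m (k + 1) := by
    have h := apply_eq_of_mem_spectralCone hn hmem hx₀
    calc _ = (1 / ((p : ℝ) ^ m * (n.descFactorial m : ℝ))) ^ (k + 1) *
          ((p : ℝ) ^ n * (n.factorial : ℝ) * convPower (freeIndicator n p m) (k + 1) x₀) := by
          rw [div_div_eq_mul_div, div_one]
          ring
      _ = coverProb n m (k + 1) := by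
        rw [h, coverProb, Finset.mul_sum]
        refine Finset.sum_congr rfl fun j _ => ?_
        rw [hw _ (Nat.sub_le n j), mul_left_comm, ← mul_pow]
        congr 2
        field_simp
  unfold topToRandomSep sep
  rw [hQ, convPower_smul, ← hval]
  congr 1
  refine le_antisymm ?_ (Finset.le_inf' _ _ fun x _ => ?_)
  · refine (Finset.inf'_le _ (Finset.mem_univ x₀)).trans_eq ?_
    rw [hU, Pi.smul_apply, smul_eq_mul]
  · rw [hU, Pi.smul_apply, smul_eq_mul]
    have := apply_le_of_mem_spectralCone hn hmem hx₀ x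
    gcongr

open ColoredPerm in
theorem topToRandomSep_antitone (n p m : ℕ) [NeZero p] : Antitone (topToRandomSep n p m) := by
  refine antitone_nat_of_succ_le fun k => ?_
  unfold topToRandomSep
  rw [convPower]
  refine sep_convLaw_le (fun x => uniformLaw_nonneg _ x) (sum_uniformLaw ⟨1, ?_⟩)
  exact ⟨fun i j _ h => by simpa using h, fun i _ => by simp⟩

/-! ### Asymptotics -/

/-! ### Bounds for ratios of falling factorials. -/

open Topology

/-- Factor by factor, `(n - j - i) / (n - i) ≤ (n - j) / n`, with denominators cleared. -/
theorem pow_mul_descFactorial_sub_le (n j m : ℕ) :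
    n ^ m * (n - j).descFactorial m ≤ (n - j) ^ m * n.descFactorial m := by
  induction m with
  | zero => simp
  | succ i ih =>
    have h : n * (n - j - i) ≤ (n - j) * (n - i) := by
      rcases le_or_gt (i + j) n with h | h
      · obtain ⟨d, rfl⟩ := Nat.exists_eq_add_of_le h
        rw [show i + j + d - j - i = d by omega, show i + j + d - j = i + d by omega,
          show i + j + d - i = j + d by omega]
        nlinarith [Nat.zero_le (i * j)]
      · simp [show n - j - i = 0 by omega]
    calc n ^ (i + 1) * (n - j).descFactorial (i + 1)
        = (n * (n - j - i)) * (n ^ i * (n - j).descFactorial i) := by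
          rw [Nat.descFactorial_succ]; ring
      _ ≤ ((n - j) * (n - i)) * ((n - j) ^ i * n.descFactorial i) := Nat.mul_le_mul h ih
      _ = _ := by rw [Nat.descFactorial_succ]; ring

/-- The factors `(n - j - i) / (n - i)` decrease in `i`, so `i = m` bounds them below. The separate
`l` lets the induction run with `m` fixed. -/
theorem pow_mul_descFactorial_le_sub {n j m l : ℕ} (hl : l ≤ m) (h : m + j ≤ n) :
    (n - m - j) ^ l * n.descFactorial l ≤ (n - m) ^ l * (n - j).descFactorial l := by
  induction l with
  | zero => simp
  | succ i ih =>
    have h : (n - m - j) * (n - i) ≤ (n - m) * (n - j - i) := by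
      obtain ⟨d, rfl⟩ := Nat.exists_eq_add_of_le h
      obtain ⟨e, rfl⟩ := Nat.exists_eq_add_of_le (show i ≤ m by omega)
      rw [show i + e + j + d - (i + e) - j = d by omega, show i + e + j + d - i = e + j + d by omega,
        show i + e + j + d - (i + e) = j + d by omega, show i + e + j + d - j - i = e + d by omega]
      nlinarith [Nat.zero_le (e * j)]
    calc (n - m - j) ^ (i + 1) * n.descFactorial (i + 1)
        = ((n - m - j) * (n - i)) * ((n - m - j) ^ i * n.descFactorial i) := by
          rw [Nat.descFactorial_succ]; ring
      _ ≤ ((n - m) * (n - j - i)) * ((n - m) ^ i * (n - j).descFactorial i) :=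
          Nat.mul_le_mul h (ih (by omega))
      _ = _ := by rw [Nat.descFactorial_succ]; ring

section Ratio

variable {n m : ℕ}

theorem descFactorial_cast_pos (hmn : m ≤ n) : (0 : ℝ) < (n.descFactorial m : ℝ) := by
  rw [Nat.cast_pos, Nat.pos_iff_ne_zero]
  exact fun h => absurd (Nat.descFactorial_eq_zero_iff_lt.1 h) (by omega)

theorem descFactorial_ratio_le (hn : 1 ≤ n) (hmn : m ≤ n) (j : ℕ) :
    ((n - j).descFactorial m : ℝ) / (n.descFactorial m : ℝ) ≤ Real.exp (-(m * (j / n))) := by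
  have hn0 : (0 : ℝ) < n := by exact_mod_cast hn
  have h1 : ((n - j : ℕ) : ℝ) / n ≤ Real.exp (-(j / n)) := by
    rcases le_or_gt j n with h | h
    · rw [Nat.cast_sub h, sub_div, div_self hn0.ne']
      exact Real.one_sub_le_exp_neg _
    · rw [Nat.sub_eq_zero_of_le h.le]
      simp [(Real.exp_pos _).le]
  calc ((n - j).descFactorial m : ℝ) / (n.descFactorial m : ℝ)
      ≤ (((n - j : ℕ) : ℝ) / n) ^ m := by
        rw [div_pow, div_le_div_iff₀ (descFactorial_cast_pos hmn) (by positivity), mul_comm]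
        exact_mod_cast pow_mul_descFactorial_sub_le n j m
    _ ≤ Real.exp (-(j / n)) ^ m := by gcongr
    _ = _ := by rw [← Real.exp_nat_mul]; ring_nf

/-- Each factor is at least `(1 + x)⁻¹ ≥ exp(-x)` with `x = j / (n - m - j)`. -/
theorem le_descFactorial_ratio {j : ℕ} (h : m + j < n) :
    Real.exp (-(m * (j / ((n : ℝ) - (m + j : ℕ))))) ≤
      ((n - j).descFactorial m : ℝ) / (n.descFactorial m : ℝ) := by
  have hd : (0 : ℝ) < (n : ℝ) - (m + j : ℕ) := by
    rw [sub_pos]; exact_mod_cast h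
  have hd' : ((n - m - j : ℕ) : ℝ) = (n : ℝ) - (m + j : ℕ) := by
    rw [Nat.sub_sub, Nat.cast_sub h.le]
  have hnm : ((n - m : ℕ) : ℝ) = (n : ℝ) - (m + j : ℕ) + j := by
    rw [Nat.cast_sub (by omega)]; push_cast; ring
  have hnm0 : (0 : ℝ) < ((n - m : ℕ) : ℝ) := by rw [hnm]; positivity
  have h1 : Real.exp (-(j / ((n : ℝ) - (m + j : ℕ)))) ≤
      ((n - m - j : ℕ) : ℝ) / ((n - m : ℕ) : ℝ) := by
    rw [Real.exp_neg, ← inv_div ((n - m : ℕ) : ℝ)]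
    refine inv_anti₀ (div_pos hnm0 (hd' ▸ hd)) ?_
    rw [hnm, hd', add_div, div_self hd.ne', add_comm]
    exact Real.add_one_le_exp _
  calc Real.exp (-(m * (j / ((n : ℝ) - (m + j : ℕ)))))
      = Real.exp (-(j / ((n : ℝ) - (m + j : ℕ)))) ^ m := by
        rw [← Real.exp_nat_mul]; ring_nf
    _ ≤ (((n - m - j : ℕ) : ℝ) / ((n - m : ℕ) : ℝ)) ^ m := by gcongr
    _ ≤ _ := by
        rw [div_pow, div_le_div_iff₀ (by positivity) (descFactorial_cast_pos (by omega)),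
          mul_comm ((_ : ℕ) : ℝ) (((n - m : ℕ) : ℝ) ^ m)]
        exact_mod_cast pow_mul_descFactorial_le_sub le_rfl h.le

theorem natCast_pow_eq_exp (hn : 1 ≤ n) (j : ℕ) : (n : ℝ) ^ j = Real.exp (j * Real.log n) := by
  rw [Real.exp_nat_mul, Real.exp_log (by exact_mod_cast hn)]

theorem pow_mul_descFactorial_ratio_pow_le (hn : 1 ≤ n) (hmn : m ≤ n) (j k : ℕ) :
    (n : ℝ) ^ j * (((n - j).descFactorial m : ℝ) / (n.descFactorial m : ℝ)) ^ k ≤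
      Real.exp (-(j * ((m : ℝ) * k / n - Real.log n))) := by
  calc _ ≤ (n : ℝ) ^ j * Real.exp (-(m * (j / n))) ^ k := by
        gcongr
        exact descFactorial_ratio_le hn hmn j
    _ = _ := by
        rw [natCast_pow_eq_exp hn, ← Real.exp_nat_mul, ← Real.exp_add]
        ring_nf

theorem le_pow_mul_descFactorial_ratio_pow {j : ℕ} (h : m + j < n) (k : ℕ) :
    Real.exp (-(j * ((m : ℝ) * k / ((n : ℝ) - (m + j : ℕ)) - Real.log n))) ≤
      (n : ℝ) ^ j * (((n - j).descFactorial m : ℝ) / (n.descFactorial m : ℝ)) ^ k := by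
  calc _ = (n : ℝ) ^ j * Real.exp (-(m * (j / ((n : ℝ) - (m + j : ℕ))))) ^ k := by
        rw [natCast_pow_eq_exp (by omega), ← Real.exp_nat_mul, ← Real.exp_add]
        ring_nf
    _ ≤ _ := by
        gcongr
        exact le_descFactorial_ratio h

end Ratio

/-! ### The coupon-collector limit. -/

theorem tendsto_mul_div_sub_sub_log {k : ℕ → ℕ} {m : ℕ} {c : ℝ}
    (hk : Tendsto (fun n : ℕ => (m : ℝ) * k n / n - Real.log n) atTop (𝓝 c)) (q : ℕ) :
    Tendsto (fun n : ℕ => (m : ℝ) * k n / ((n : ℝ) - q) - Real.log n) atTop (𝓝 c) := by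
  have h1 : Tendsto (fun n : ℕ => (n : ℝ) / ((n : ℝ) - q)) atTop (𝓝 1) := by
    simpa [sub_eq_add_neg] using tendsto_natCast_div_add_atTop (-(q : ℝ))
  have h2 : Tendsto (fun n : ℕ => Real.log n / (n : ℝ)) atTop (𝓝 0) :=
    (Real.isLittleO_log_id_atTop.tendsto_div_nhds_zero).comp tendsto_natCast_atTop_atTop
  -- Changing the denominator from `n` to `n - q` costs only a multiple of `log n / n`.
  have h3 := (hk.mul h1).add ((h2.mul h1).const_mul (q : ℝ))
  simp only [mul_one, mul_zero, add_zero] at h3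
  refine h3.congr' ?_
  filter_upwards [eventually_gt_atTop q] with n hn
  have hn0 : (n : ℝ) ≠ 0 := Nat.cast_ne_zero.2 (by omega)
  have hq : (n : ℝ) - q ≠ 0 := (sub_pos.2 (Nat.cast_lt.2 hn)).ne'
  field_simp
  ring

/-- Combines `n.choose j ∼ n^j / j!` with the squeeze of `n^j` times the ratio power to `exp(-j c)`.
-/
theorem tendsto_coverProb_term {k : ℕ → ℕ} {m : ℕ} {c : ℝ}
    (hk : Tendsto (fun n : ℕ => (m : ℝ) * k n / n - Real.log n) atTop (𝓝 c)) (j : ℕ) :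
    Tendsto (fun n : ℕ => (-1 : ℝ) ^ j * (n.choose j : ℝ) *
        (((n - j).descFactorial m : ℝ) / (n.descFactorial m : ℝ)) ^ k n) atTop
      (𝓝 ((-Real.exp (-c)) ^ j / (j.factorial : ℝ))) := by
  have hpow : Tendsto (fun n : ℕ => (n : ℝ) ^ j *
      (((n - j).descFactorial m : ℝ) / (n.descFactorial m : ℝ)) ^ k n) atTop
      (𝓝 (Real.exp (-(j * c)))) := by
    refine tendsto_of_tendsto_of_tendsto_of_le_of_le'
      (g := fun n : ℕ => Real.exp (-(j * ((m : ℝ) * k n / ((n : ℝ) - (m + j : ℕ)) - Real.log n))))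
      (h := fun n : ℕ => Real.exp (-(j * ((m : ℝ) * k n / n - Real.log n)))) ?_ ?_ ?_ ?_
    · exact (Real.continuous_exp.tendsto _).comp
        ((tendsto_mul_div_sub_sub_log hk (m + j)).const_mul (j : ℝ)).neg
    · exact (Real.continuous_exp.tendsto _).comp (hk.const_mul (j : ℝ)).neg
    · filter_upwards [eventually_gt_atTop (m + j)] with n hn
      exact le_pow_mul_descFactorial_ratio_pow hn _
    · filter_upwards [eventually_ge_atTop (m + 1)] with n hn
      exact pow_mul_descFactorial_ratio_pow_le (by omega) (by omega) _ _
  have hz : ∀ᶠ n : ℕ in atTop, (n : ℝ) ^ j / (j.factorial : ℝ) ≠ 0 := by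
    filter_upwards [eventually_gt_atTop 0] with n hn
    positivity
  have hch := (isEquivalent_iff_tendsto_one hz).1 (isEquivalent_choose j)
  have h := ((hch.mul hpow).const_mul ((-1 : ℝ) ^ j / (j.factorial : ℝ)))
  have hlim : (-1 : ℝ) ^ j / (j.factorial : ℝ) * (1 * Real.exp (-(j * c))) =
      (-Real.exp (-c)) ^ j / (j.factorial : ℝ) := by
    rw [neg_pow (Real.exp (-c)), ← Real.exp_nat_mul]
    ring_nf
  rw [hlim] at h
  refine h.congr' ?_
  filter_upwards [eventually_gt_atTop 0] with n hn
  have hn0 : (n : ℝ) ^ j ≠ 0 := by positivity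
  simp only [Pi.div_apply]
  field_simp

/-- The Erdős–Rényi limit law for the coupon collector with batches of fixed size. -/
theorem tendsto_coverProb {k : ℕ → ℕ} {m : ℕ} {c : ℝ}
    (hk : Tendsto (fun n : ℕ => (m : ℝ) * k n / n - Real.log n) atTop (𝓝 c)) :
    Tendsto (fun n : ℕ => coverProb n m (k n)) atTop (𝓝 (Real.exp (-Real.exp (-c)))) := by
  have hsum (n : ℕ) : coverProb n m (k n) = ∑' j : ℕ, (-1 : ℝ) ^ j * (n.choose j : ℝ) *
      (((n - j).descFactorial m : ℝ) / (n.descFactorial m : ℝ)) ^ k n := by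
    rw [coverProb, tsum_eq_sum]
    intro j hj
    rw [Nat.choose_eq_zero_of_lt (by simpa using hj)]
    simp
  have hexp : Real.exp (-Real.exp (-c)) =
      ∑' j : ℕ, (-Real.exp (-c)) ^ j / (j.factorial : ℝ) := by
    rw [Real.exp_eq_exp_ℝ]
    exact (NormedSpace.expSeries_div_hasSum_exp _).tsum_eq.symm
  simp only [hsum]
  rw [hexp]
  -- Eventually `m k / n - log n > c - 1`, which bounds the `j`-th term by `exp(j (1 - c)) / j!`.
  refine tendsto_tsum_of_dominated_convergence
    (bound := fun j : ℕ => Real.exp (1 - c) ^ j / (j.factorial : ℝ))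
    (Real.summable_pow_div_factorial _) (tendsto_coverProb_term hk) ?_
  filter_upwards [eventually_ge_atTop (m + 1), hk.eventually_const_lt (show c - 1 < c by linarith)]
    with n hn hc j
  have hr : 0 ≤ (((n - j).descFactorial m : ℝ) / (n.descFactorial m : ℝ)) ^ k n := by positivity
  rw [norm_mul, norm_mul, norm_pow, norm_neg, norm_one, one_pow, one_mul,
    Real.norm_of_nonneg (Nat.cast_nonneg _), Real.norm_of_nonneg hr]
  calc _ ≤ (n : ℝ) ^ j / (j.factorial : ℝ) *
        (((n - j).descFactorial m : ℝ) / (n.descFactorial m : ℝ)) ^ k n := by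
        gcongr
        exact Nat.choose_le_pow_div j n
    _ = (n : ℝ) ^ j * (((n - j).descFactorial m : ℝ) / (n.descFactorial m : ℝ)) ^ k n /
        (j.factorial : ℝ) := by ring
    _ ≤ Real.exp (-(j * ((m : ℝ) * k n / n - Real.log n))) / (j.factorial : ℝ) := by
        gcongr
        exact pow_mul_descFactorial_ratio_pow_le (by omega) (by omega) _ _
    _ ≤ _ := by
        rw [← Real.exp_nat_mul]
        gcongr
        nlinarith [(Nat.cast_nonneg j : (0 : ℝ) ≤ j)]

/-- For fixed `n` every term with `j ≥ 1` decays geometrically. This makes the mixing time well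
defined. -/
theorem tendsto_coverProb_atTop {n m : ℕ} (hm : 1 ≤ m) (hmn : m ≤ n) :
    Tendsto (coverProb n m) atTop (𝓝 1) := by
  have hn : 1 ≤ n := hm.trans hmn
  have h1 : (1 : ℝ) = ∑ j ∈ Finset.range (n + 1), if j = 0 then 1 else 0 := by simp
  rw [h1]
  refine tendsto_finsetSum _ fun j _ => ?_
  rcases eq_or_ne j 0 with rfl | hj
  · simp [div_self (descFactorial_cast_pos hmn).ne']
  · rw [if_neg hj]
    have hlt : ((n - j).descFactorial m : ℝ) / (n.descFactorial m : ℝ) < 1 := by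
      refine (descFactorial_ratio_le hn hmn j).trans_lt (Real.exp_lt_one_iff.2 ?_)
      have hm0 : (0 : ℝ) < m := by exact_mod_cast hm
      have hn0 : (0 : ℝ) < n := by exact_mod_cast hn
      have hj0 : (0 : ℝ) < j := by exact_mod_cast Nat.pos_of_ne_zero hj
      rw [neg_lt_zero]
      positivity
    simpa using (tendsto_pow_atTop_nhds_zero_of_lt_one (by positivity) hlt).const_mul
      ((-1 : ℝ) ^ j * (n.choose j : ℝ))

/-! ### Threshold times and the mixing time. -/

/-- The number of batches at the coupon collector threshold with offset `c`. -/
noncomputable def thresholdTime (m : ℕ) (c : ℝ) (n : ℕ) : ℕ :=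
  ⌊(n : ℝ) / m * (Real.log n + c)⌋₊

theorem tendsto_log_natCast_add_atTop (c : ℝ) :
    Tendsto (fun n : ℕ => Real.log n + c) atTop atTop :=
  tendsto_atTop_add_const_right _ _ (Real.tendsto_log_atTop.comp tendsto_natCast_atTop_atTop)

theorem tendsto_thresholdTime {m : ℕ} (hm : 1 ≤ m) (c : ℝ) :
    Tendsto (fun n : ℕ => (m : ℝ) * thresholdTime m c n / n - Real.log n) atTop (𝓝 c) := by
  have hm0 : (0 : ℝ) < m := by exact_mod_cast hm
  have hlow : Tendsto (fun n : ℕ => c - (m : ℝ) / n) atTop (𝓝 c) := by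
    simpa using (tendsto_const_div_atTop_nhds_zero_nat (m : ℝ)).const_sub c
  refine tendsto_of_tendsto_of_tendsto_of_le_of_le' hlow tendsto_const_nhds ?_ ?_
  · filter_upwards [eventually_gt_atTop 0] with n hn
    have hn0 : (0 : ℝ) < n := by exact_mod_cast hn
    have h := Nat.lt_floor_add_one ((n : ℝ) / m * (Real.log n + c))
    have h2 : Real.log n + c ≤ (m : ℝ) / n * (thresholdTime m c n + 1) := by
      calc Real.log n + c = (m : ℝ) / n * ((n : ℝ) / m * (Real.log n + c)) := by field_simp
        _ ≤ _ := by gcongr; exact h.le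
    have h3 : (m : ℝ) / n * (thresholdTime m c n + 1) =
        (m : ℝ) * thresholdTime m c n / n + (m : ℝ) / n := by ring
    linarith
  · filter_upwards [eventually_gt_atTop 0,
      (tendsto_log_natCast_add_atTop c).eventually_ge_atTop 0] with n hn hlog
    have hn0 : (0 : ℝ) < n := by exact_mod_cast hn
    have h := Nat.floor_le (show 0 ≤ (n : ℝ) / m * (Real.log n + c) by positivity)
    have h2 : (m : ℝ) / n * (thresholdTime m c n) ≤ Real.log n + c := by
      calc _ ≤ (m : ℝ) / n * ((n : ℝ) / m * (Real.log n + c)) := by gcongr; exact h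
        _ = _ := by field_simp
    have h3 : (m : ℝ) / n * thresholdTime m c n = (m : ℝ) * thresholdTime m c n / n := by ring
    linarith

theorem eventually_one_le_thresholdTime {m : ℕ} (hm : 1 ≤ m) (c : ℝ) :
    ∀ᶠ n : ℕ in atTop, 1 ≤ thresholdTime m c n := by
  have hm0 : (0 : ℝ) < m := by exact_mod_cast hm
  filter_upwards [eventually_ge_atTop m,
    (tendsto_log_natCast_add_atTop c).eventually_ge_atTop 1] with n hn hlog
  rw [thresholdTime, Nat.one_le_floor_iff]
  have : 1 ≤ (n : ℝ) / m := (one_le_div hm0).2 (by exact_mod_cast hn)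
  nlinarith

theorem tendsto_topToRandomSep_thresholdTime {p m : ℕ} [NeZero p] (hp : 2 ≤ p) (hm : 1 ≤ m)
    (c : ℝ) : Tendsto (fun n => topToRandomSep n p m (thresholdTime m c n)) atTop
      (𝓝 (1 - Real.exp (-Real.exp (-c)))) := by
  refine ((tendsto_coverProb (tendsto_thresholdTime hm c)).const_sub 1).congr' ?_
  filter_upwards [eventually_ge_atTop m, eventually_one_le_thresholdTime hm c] with n hn hk
  obtain ⟨l, hl⟩ := Nat.exists_eq_add_of_le' hk
  rw [hl, topToRandomSep_succ hp (hm.trans hn) hn]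

theorem isLeast_sepMixingTime {n p m : ℕ} [NeZero p] (hp : 2 ≤ p) (hm : 1 ≤ m) (hmn : m ≤ n)
    {ε : ℝ} (hε : 0 < ε) :
    IsLeast {k : ℕ | topToRandomSep n p m k ≤ ε} (sepMixingTime n p m ε) := by
  have hev : ∀ᶠ k in atTop, 1 - ε < coverProb n m k :=
    (tendsto_coverProb_atTop hm hmn).eventually_const_lt (by linarith)
  -- The shift by one is there because the separation formula is stated at positive times.
  obtain ⟨k, hk⟩ := ((tendsto_add_atTop_nat 1).eventually hev).exists
  have hne : {k : ℕ | topToRandomSep n p m k ≤ ε}.Nonempty := by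
    refine ⟨k + 1, ?_⟩
    change topToRandomSep n p m (k + 1) ≤ ε
    rw [topToRandomSep_succ hp (hm.trans hmn) hmn]
    linarith
  exact ⟨Nat.sInf_mem hne, fun l hl => Nat.sInf_le hl⟩

/-- For every `n ≥ m` the separation mixing time is an attained minimum, and as `n → ∞` it equals
`(n / m) (log n - log (-log (1 - ε))) + o(n)`. -/
theorem mainTheorem8 (p : ℕ) [NeZero p] (hp : 2 ≤ p) (m : ℕ) (hm : 1 ≤ m)
    (ε : ℝ) (hε0 : 0 < ε) (hε1 : ε < 1) :
    (∀ n : ℕ, m ≤ n →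
      IsLeast {k : ℕ | topToRandomSep n p m k ≤ ε} (sepMixingTime n p m ε)) ∧
    (fun n : ℕ => (sepMixingTime n p m ε : ℝ) -
        (n : ℝ) / (m : ℝ) * (Real.log n - Real.log (-Real.log (1 - ε))))
      =o[atTop] (fun n : ℕ => (n : ℝ)) := by
  refine ⟨fun n hn => isLeast_sepMixingTime hp hm hn hε0, ?_⟩
  have hm0 : (0 : ℝ) < m := by exact_mod_cast hm
  set c : ℝ := -Real.log (-Real.log (1 - ε)) with hc
  have hlim : 1 - Real.exp (-Real.exp (-c)) = ε := by
    have hlog : Real.log (1 - ε) < 0 := Real.log_neg (by linarith) (by linarith)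
    rw [hc, neg_neg, Real.exp_log (by linarith), neg_neg, Real.exp_log (by linarith)]
    ring
  rw [isLittleO_iff]
  intro C hC
  -- Shifting the offset by `C m` moves the threshold by `(n / m) C m = C n`, the allowed error.
  have hδ : 0 < C * m := by positivity
  have hhi : 1 - Real.exp (-Real.exp (-(c + C * m))) < ε := by
    rw [← hlim]
    gcongr
    linarith
  have hlo : ε < 1 - Real.exp (-Real.exp (-(c - C * m))) := by
    conv_lhs => rw [← hlim]
    gcongr
    linarith
  filter_upwards [eventually_ge_atTop m, (tendsto_log_natCast_add_atTop (c + C * m)).eventually_ge_atTop 0,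
    (tendsto_topToRandomSep_thresholdTime hp hm (c + C * m)).eventually_lt_const hhi,
    (tendsto_topToRandomSep_thresholdTime hp hm (c - C * m)).eventually_const_lt hlo]
    with n hn hlog h1 h2
  have hleast := isLeast_sepMixingTime (n := n) (p := p) hp hm hn hε0
  have hup : sepMixingTime n p m ε ≤ thresholdTime m (c + C * m) n := hleast.2 h1.le
  have hdown : thresholdTime m (c - C * m) n < sepMixingTime n p m ε := by
    by_contra! h
    exact absurd ((topToRandomSep_antitone n p m h).trans hleast.1) h2.not_ge
  have hup' : (sepMixingTime n p m ε : ℝ) ≤ (n : ℝ) / m * (Real.log n + (c + C * m)) :=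
    (Nat.cast_le.2 hup).trans (Nat.floor_le (by positivity))
  -- The mixing time is nonzero by `hdown`, so no sign condition on the real threshold is needed.
  have hdown' : (n : ℝ) / m * (Real.log n + (c - C * m)) < sepMixingTime n p m ε :=
    (Nat.floor_lt' (by omega)).1 hdown
  have e1 : (n : ℝ) / m * (Real.log n + (c + C * m)) =
      (n : ℝ) / m * (Real.log n + c) + C * n := by field_simp; ring
  have e2 : (n : ℝ) / m * (Real.log n + (c - C * m)) =
      (n : ℝ) / m * (Real.log n + c) - C * n := by field_simp; ring
  have e3 : Real.log n - Real.log (-Real.log (1 - ε)) = Real.log n + c := by rw [hc]; ring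
  rw [Real.norm_of_nonneg (Nat.cast_nonneg n), Real.norm_eq_abs, abs_le, e3]
  constructor <;> linarith
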